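/- **Conventions.** A *simplex* is a compact convex subset $K$ of a metric linear space, on which the metric is convex, such that every $p\in K$ is the barycenter of a unique Borel probability measure on the set $\mathsf{ex}\,K$ of extreme points of $K$. It is a *zero-dimensional Bauer simplex* if $\mathsf{ex}\,K$ is closed and zero-dimensional. A *face* of $K$ is a compact convex set $F\subset K$ with $\mathsf{ex}\,F\subset\mathsf{ex}\,K$. A *measure-preserving system* is a standard probability space together with a measure-automorphism; $\approx$ denotes measure-theoretic isomorphism of such systems. An *assignment* on $K$ is a map $\Phi$ from $K$ to measure-preserving systems such that $\Phi(e)$ is ergodic for every $e\in\mathsf{ex}\,K$ and $\Phi(p)\approx\int\Phi(e)\,d\xi(e)$ (the integral being realized on a disjoint union of the spaces of the systems $\Phi(e)$) whenever $p\in K$ is the barycenter of a probability measure $\xi$ on $\mathsf{ex}\,K$. It is *aperiodic* if, for every $e\in\mathsf{ex}\,K$, almost every point of $\Phi(e)$ is non-periodic. A *topological dynamical system* $(X,T)$ is a compact metric space $X$ with a homeomorphism $T:X\to X$; it is *zero-dimensional* if $X$ is. Let $\mathcal M_T(X)$ be the simplex of $T$-invariant Borel probability measures on $X$ with the weak-star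 topology. The assignment $\Phi$ *can be embedded* in $(X,T)$ if there are a face $F$ of $\mathcal M_T(X)$ and an affine homeomorphism $\pi:K\to F$ such that $\Phi(p)\approx(X,\mathsf{Borel}(X),\pi(p),T)$ for every $p\in K$. **Theorem.** Let $\Phi$ be an aperiodic assignment on a zero-dimensional Bauer simplex $K$, and assume that $\Phi$ can be embedded in a topological dynamical system. Then $\Phi$ can be embedded in a zero-dimensional topological dynamical system. -/

import Mathlib

open MeasureTheory ProbabilityTheory
open scoped NNReal

universe u v w

/-! ### Measure-preserving systems -/

/-- `(X, μ, T)` and `(Y, ν, S)` are measure-theoretically isomorphic: there are measure-preserving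
maps in both directions, inverse to each other almost everywhere, that intertwine `T` and `S`
almost everywhere. -/
def MeasureIsomorphic {X : Type*} [MeasurableSpace X] {Y : Type*} [MeasurableSpace Y]
    (μ : Measure X) (T : X → X) (ν : Measure Y) (S : Y → Y) : Prop :=
  ∃ (φ : X → Y) (ψ : Y → X), MeasurePreserving φ μ ν ∧ MeasurePreserving ψ ν μ ∧
    (∀ᵐ x ∂μ, ψ (φ x) = x) ∧ (∀ᵐ y ∂ν, φ (ψ y) = y) ∧ ∀ᵐ x ∂μ, φ (T x) = S (φ x)

/-- A standard probability space with a measure-automorphism (a measure-preserving self-map that is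
invertible up to null sets). -/
structure MPSystem : Type (u + 1) where
  carrier : Type u
  [measurableSpace : MeasurableSpace carrier]
  [standardBorel : StandardBorelSpace carrier]
  μ : Measure carrier
  [isProb : IsProbabilityMeasure μ]
  T : carrier → carrier
  preserving : MeasurePreserving T μ μ
  invertible : ∃ R : carrier → carrier, MeasurePreserving R μ μ ∧
    (∀ᵐ x ∂μ, R (T x) = x) ∧ ∀ᵐ x ∂μ, T (R x) = x

namespace MPSystem

attribute [instance] measurableSpace standardBorel isProb

/-- Measure-theoretic isomorphism of measure-preserving systems. -/
def Isomorphic (M : MPSystem.{u}) (N : MPSystem.{v}) : Prop :=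
  MeasureIsomorphic M.μ M.T N.μ N.T

/-- Almost every point is not periodic. -/
def Aperiodic (M : MPSystem.{u}) : Prop :=
  ∀ᵐ x ∂M.μ, x ∉ Function.periodicPts M.T

/-- `M` is a realization of the integral `∫ Ψ(e) dξ(e)` on a disjoint union: the space of `M` is
partitioned by a measurable map `q` into fibres `q⁻¹(e)`; the measure of `M` is the `ξ`-integral of
probability measures `κ e`, where, for `ξ`-almost every `e`, the measure `κ e` is carried by the
fibre over `e`, is invariant, and makes that fibre a copy of the system `Ψ e`. -/
def IsIntegral {B : Type w} [MeasurableSpace B] (ξ : Measure B) (Ψ : B → MPSystem.{u})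
    (M : MPSystem.{v}) : Prop :=
  ∃ (q : M.carrier → B) (κ : Kernel B M.carrier), Measurable q ∧ IsMarkovKernel κ ∧
    ξ.bind κ = M.μ ∧
    ∀ᵐ e ∂ξ, (∀ᵐ x ∂κ e, q x = e) ∧ MeasurePreserving M.T (κ e) (κ e) ∧
      MeasureIsomorphic (κ e) M.T (Ψ e).μ (Ψ e).T

end MPSystem

/-! ### Simplices

Affine maps, faces and equivalences use nonnegative scalars only, so that they apply both to subsets
of real vector spaces and to sets of finite measures with the weak-star topology. -/

/-- A map on a subset `K` is affine if it respects all convex combinations that lie in `K`. -/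
def IsAffine {E : Type*} [AddCommMonoid E] [Module ℝ≥0 E] {V : Type*} [AddCommMonoid V]
    [Module ℝ≥0 V] {K : Set E} (f : K → V) : Prop :=
  ∀ (x y z : K) (a b : ℝ≥0), a + b = 1 → (z : E) = a • (x : E) + b • (y : E) →
    f z = a • f x + b • f y

/-- `F` is a face of `K`: a compact convex subset whose extreme points are extreme in `K`. -/
structure IsFace {E : Type*} [AddCommMonoid E] [Module ℝ≥0 E] [TopologicalSpace E]
    (F K : Set E) : Prop where
  subset : F ⊆ K
  compact : IsCompact F
  convex : Convex ℝ≥0 F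
  extreme : F.extremePoints ℝ≥0 ⊆ K.extremePoints ℝ≥0

/-- `p` is the barycenter of the measure `ξ` on the extreme points of `K`: every continuous affine
function on `K` has at `p` the value of its `ξ`-average. -/
def IsBarycenter {E : Type*} [AddCommGroup E] [Module ℝ E] [TopologicalSpace E]
    [MeasurableSpace E] (K : Set E) (ξ : Measure (K.extremePoints ℝ)) (p : K) : Prop :=
  ∀ f : K → ℝ, Continuous f → IsAffine f →
    ∫ e, f (Set.inclusion extremePoints_subset e) ∂ξ = f p

/-- A metrizable Choquet simplex: a compact convex set in a metric linear space, on which the metric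
is convex, each of whose points is the barycenter of exactly one Borel probability measure on the
set of extreme points. -/
structure IsSimplex {E : Type*} [AddCommGroup E] [Module ℝ E] [MetricSpace E]
    [MeasurableSpace E] (K : Set E) : Prop where
  compact : IsCompact K
  convex : Convex ℝ K
  convex_dist : ∀ x ∈ K, ∀ y ∈ K, ∀ z ∈ K, ∀ a b : ℝ, 0 ≤ a → 0 ≤ b → a + b = 1 →
    dist z (a • x + b • y) ≤ a * dist z x + b * dist z y
  existsUnique_barycenter : ∀ p : K, ∃! ξ : ProbabilityMeasure (K.extremePoints ℝ),
    IsBarycenter K (ξ : Measure (K.extremePoints ℝ)) p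

/-- A topological space is zero-dimensional if its clopen sets form a base. -/
def IsZeroDimensional (X : Type*) [TopologicalSpace X] : Prop :=
  TopologicalSpace.IsTopologicalBasis {s : Set X | IsClopen s}

/-- A zero-dimensional Bauer simplex: the set of extreme points is closed and zero-dimensional. -/
structure IsZeroDimBauerSimplex {E : Type*} [AddCommGroup E] [Module ℝ E] [MetricSpace E]
    [MeasurableSpace E] (K : Set E) : Prop extends IsSimplex K where
  closed_extremePoints : IsClosed (K.extremePoints ℝ)
  zeroDim_extremePoints : IsZeroDimensional (K.extremePoints ℝ)

/-! ### Assignments -/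

/-- An assignment on `K`: extreme points are assigned ergodic systems, and the map is harmonic. -/
structure IsAssignment {E : Type*} [AddCommGroup E] [Module ℝ E] [TopologicalSpace E]
    [MeasurableSpace E] (K : Set E) (Φ : K → MPSystem.{u}) : Prop where
  ergodic : ∀ p : K, (p : E) ∈ K.extremePoints ℝ → Ergodic (Φ p).T (Φ p).μ
  harmonic : ∀ (p : K) (ξ : ProbabilityMeasure (K.extremePoints ℝ)),
    IsBarycenter K (ξ : Measure (K.extremePoints ℝ)) p →
    ∃ M : MPSystem.{u}, MPSystem.IsIntegral (ξ : Measure (K.extremePoints ℝ))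
      (fun e => Φ (Set.inclusion extremePoints_subset e)) M ∧ (Φ p).Isomorphic M

/-- An assignment is aperiodic if the systems at the extreme points are. -/
def IsAperiodicAssignment {E : Type*} [AddCommGroup E] [Module ℝ E] (K : Set E)
    (Φ : K → MPSystem.{u}) : Prop :=
  ∀ p : K, (p : E) ∈ K.extremePoints ℝ → (Φ p).Aperiodic

/-- `Φ` on `K` and `Φ'` on `K'` are equivalent: some affine homeomorphism `π : K → K'` satisfies
`Φ p ≈ Φ' (π p)` for all `p ∈ K`. -/
def AssignmentEquivalent {E : Type*} [AddCommMonoid E] [Module ℝ≥0 E] [TopologicalSpace E]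
    {E' : Type*} [AddCommMonoid E'] [Module ℝ≥0 E'] [TopologicalSpace E']
    {K : Set E} {K' : Set E'} (Φ : K → MPSystem.{u}) (Φ' : K' → MPSystem.{v}) : Prop :=
  ∃ π : K ≃ₜ K', IsAffine (fun p => (π p : E')) ∧ ∀ p, (Φ p).Isomorphic (Φ' (π p))

/-! ### Topological dynamical systems -/

/-- A compact metric space with a self-homeomorphism. -/
structure TopSystem : Type (u + 1) where
  carrier : Type u
  [metric : MetricSpace carrier]
  [compact : CompactSpace carrier]
  T : carrier ≃ₜ carrier

namespace TopSystem

attribute [instance] metric compact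

instance (S : TopSystem.{u}) : MeasurableSpace S.carrier := borel S.carrier

instance (S : TopSystem.{u}) : BorelSpace S.carrier := ⟨rfl⟩

/-- The set of invariant Borel probability measures, inside the finite measures with the weak-star
topology. -/
def invariantMeasures (S : TopSystem.{u}) : Set (FiniteMeasure S.carrier) :=
  {μ | IsProbabilityMeasure (μ : Measure S.carrier) ∧
    MeasurePreserving S.T (μ : Measure S.carrier) (μ : Measure S.carrier)}

/-- The natural assignment `μ ↦ (X, Borel(X), μ, T)`. -/
noncomputable def naturalAssignment (S : TopSystem.{u}) (μ : S.invariantMeasures) :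
    MPSystem.{u} :=
  haveI := μ.2.1
  { carrier := S.carrier
    μ := (μ : FiniteMeasure S.carrier)
    T := S.T
    preserving := μ.2.2
    invertible := ⟨S.T.symm, μ.2.2.symm S.T.toMeasurableEquiv,
      Filter.Eventually.of_forall fun x => S.T.symm_apply_apply x,
      Filter.Eventually.of_forall fun x => S.T.apply_symm_apply x⟩ }

end TopSystem

/-- `Φ` can be embedded in `S`: it is equivalent to a face of the natural assignment of `S`. -/
def EmbedsIn {E : Type*} [AddCommMonoid E] [Module ℝ≥0 E] [TopologicalSpace E] {K : Set E}
    (Φ : K → MPSystem.{u}) (S : TopSystem.{v}) : Prop :=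
  ∃ (F : Set (FiniteMeasure S.carrier)) (hF : IsFace F S.invariantMeasures),
    AssignmentEquivalent Φ (fun μ : F => S.naturalAssignment (Set.inclusion hF.subset μ))

/-!
Let `Q` be the set of extreme points of `K`, and let `m p` be the invariant measure that realizes
`Φ p` in the given system `(X, T)`, so that `m` is continuous, affine and injective. It is enough to
find an injective Borel map `ψ` from `X` to a zero-dimensional system that intertwines the two
homeomorphisms almost everywhere and for which `p ↦ ψ_* (m p)` is continuous: the image of `K` is
then a compact convex set of invariant measures, its extreme points are ergodic and hence extreme
among all invariant measures, and `ψ` is an isomorphism for each `m p`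
(`TopSystem.embedsIn_of_continuous_injective`).

A symbolic coding of `X` by sets `{f > c}`, with `f` continuous, pushes measures forward
continuously if the level sets `{f = c}` are null for all the measures concerned. There need not be such a
constant `c`, but the level may depend on the ergodic component. As `Q` is compact and
zero-dimensional, Baire's theorem provides continuous functions `τ : Q → ℝ`, with values in any
prescribed interval, such that `{f = τ e}` is null for `m e`, for every `e ∈ Q`
(`exists_continuous_level_measure_eq_zero`). Countably many inequalities `τ e < f (T ^ n x)` yield a
coding `φ` of `Q × X` that is equivariant, separates the points of `X`, and is continuous almost
everywhere for the measure `m e` on the fibre over each `e` (`exists_coding`).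

To code `X` itself, the component has to be read off from the point. The mean ergodic theorem holds
uniformly over the compact set `Q`, by Dini's theorem, so that along one subsequence the Birkhoff
averages converge almost everywhere for all the measures `m e` simultaneously; this gives a Borel
map `q : X → Q` equal to `e` almost everywhere for `m e` (`exists_measurable_ae_eq_index`).
Put `ψ x = φ (q x, x)`.

Finally, if `ξ p` is the measure on `Q` with barycenter `p`, then `m p` is the integral of the `m e`
with respect to `ξ p`, and its image under `x ↦ (q x, x)` is the integral of these measures placed
on the fibres of `Q × X`. This image depends continuously on `ξ p`, and `ξ p` depends continuously on
`p` because barycenters are unique and the probability measures on `Q` form a compact space. By the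
mapping theorem (`tendsto_map_of_ae_continuousAt`), `p ↦ ψ_* (m p)` is continuous.
-/

open Filter Topology Set
open scoped ENNReal

/-! ### Weak convergence and sets with null boundary -/

/-- The mapping theorem: pushing forward along a Borel map that is continuous almost everywhere for
the limit measure preserves weak convergence. -/
theorem tendsto_map_of_ae_continuousAt {ι Y Z : Type*} {L : Filter ι} [L.IsCountablyGenerated]
    [TopologicalSpace Y] [MeasurableSpace Y] [BorelSpace Y] [HasOuterApproxClosed Y]
    [TopologicalSpace Z] [MeasurableSpace Z] [BorelSpace Z]
    {μs : ι → ProbabilityMeasure Y} {μ : ProbabilityMeasure Y} (h : Tendsto μs L (𝓝 μ))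
    {φ : Y → Z} (hφ : Measurable φ) (hc : ∀ᵐ y ∂(μ : Measure Y), ContinuousAt φ y) :
    Tendsto (fun i => (μs i).map hφ.aemeasurable) L (𝓝 (μ.map hφ.aemeasurable)) := by
  refine tendsto_of_forall_isOpen_le_liminf' fun G hG => ?_
  simp only [ProbabilityMeasure.map_apply' _ _ hG.measurableSet]
  calc (μ : Measure Y) (φ ⁻¹' G) ≤ (μ : Measure Y) (interior (φ ⁻¹' G)) := by
        refine measure_mono_ae ?_
        filter_upwards [hc] with y hy hyG
        exact mem_interior_iff_mem_nhds.2 (hy (hG.mem_nhds hyG))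
    _ ≤ L.liminf fun i => (μs i : Measure Y) (interior (φ ⁻¹' G)) :=
        ProbabilityMeasure.le_liminf_measure_open_of_tendsto h isOpen_interior
    _ ≤ L.liminf fun i => (μs i : Measure Y) (φ ⁻¹' G) :=
        liminf_le_liminf (Eventually.of_forall fun i => measure_mono interior_subset)

/-- The mass of a level set `{f = t}` is upper semicontinuous in the measure and the level. -/
theorem isOpen_setOf_measure_level_lt {Q X : Type*} [TopologicalSpace Q] [TopologicalSpace X]
    [TopologicalSpace.PseudoMetrizableSpace X] [SecondCountableTopology X]
    [MeasurableSpace X] [BorelSpace X]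
    {P : Q → ProbabilityMeasure X} (hP : Continuous P) (f : C(X, ℝ)) (r : ℝ≥0∞) :
    IsOpen {p : Q × ℝ | (P p.1 : Measure X) {x | f x = p.2} < r} := by
  have hclosed : IsClosed {y : X × ℝ | f y.1 = y.2} := isClosed_eq (by fun_prop) (by fun_prop)
  -- The level set `{f = t}` is the slice at `t` of the closed graph of `f`.
  have key : ∀ p : Q × ℝ, (P p.1 : Measure X) {x | f x = p.2} =
      ((P p.1).prod (diracProba p.2) : Measure (X × ℝ)) {y : X × ℝ | f y.1 = y.2} := by
    intro p
    have h : MeasurableSet {y : X × ℝ | f y.1 = y.2} := hclosed.measurableSet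
    change _ = ((P p.1 : Measure X).prod (Measure.dirac p.2)) _
    rw [Measure.prod_dirac, Measure.map_apply (by fun_prop) h]
    rfl
  have hcont : Continuous fun p : Q × ℝ => (P p.1).prod (diracProba p.2) :=
    ProbabilityMeasure.continuous_prod.comp
      ((hP.comp continuous_fst).prodMk (continuous_diracProba.comp continuous_snd))
  refine isOpen_iff_mem_nhds.2 fun p hp => ?_
  simp only [mem_ofPred_eq, key] at hp ⊢
  exact eventually_lt_of_limsup_lt
    ((ProbabilityMeasure.limsup_measure_closed_le_of_tendsto (hcont.tendsto p) hclosed).trans_lt hp)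

/-- All but countably many levels of a measurable function are null. -/
theorem exists_level_measure_eq_zero {X : Type*} [MeasurableSpace X] (μ : Measure X) [SFinite μ]
    {f : X → ℝ} (hf : Measurable f) {s t : ℝ} (hst : s < t) :
    ∃ c ∈ Ioo s t, μ {x | f x = c} = 0 := by
  have h : Set.Countable {c : ℝ | 0 < μ (f ⁻¹' {c})} := by
    refine Measure.countable_meas_pos_of_disjoint_iUnion
      (fun c => hf (measurableSet_singleton c)) ?_
    intro c d hcd
    exact Disjoint.preimage f (by simpa using hcd)
  have h2 : ¬ (Ioo s t) ⊆ {c : ℝ | 0 < μ (f ⁻¹' {c})} := fun hsub =>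
    (Cardinal.Real.Ioo_countable_iff.not.2 (not_le.2 hst)) (h.mono hsub)
  obtain ⟨c, hc, hc'⟩ := not_subset.1 h2
  exact ⟨c, hc, by simpa [preimage] using hc'⟩

/-- On a compact zero-dimensional space, a set of pairs that is open and meets every fibre contains
the graph of a continuous function. -/
theorem exists_continuousMap_graph_subset {Q Y : Type*} [TopologicalSpace Q] [CompactSpace Q]
    [TopologicalSpace Y] (hQ : IsZeroDimensional Q) {G : Set (Q × Y)} (hG : IsOpen G)
    (hne : ∀ e, ∃ y, (e, y) ∈ G) : ∃ g : C(Q, Y), ∀ e, (e, g e) ∈ G := by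
  rcases isEmpty_or_nonempty Q with hemp | ⟨⟨e₀⟩⟩
  · exact ⟨⟨fun e => (hemp.false e).elim, continuous_of_const fun e => (hemp.false e).elim⟩,
      fun e => (hemp.false e).elim⟩
  have main : ∃ W : Set Q, IsClopen W ∧ univ ⊆ W ∧ ∃ g : C(Q, Y), ∀ e ∈ W, (e, g e) ∈ G := by
    refine isCompact_univ.induction_on
      (p := fun s : Set Q => ∃ W : Set Q, IsClopen W ∧ s ⊆ W ∧ ∃ g : C(Q, Y), ∀ e ∈ W, (e, g e) ∈ G)
      ?_ ?_ ?_ ?_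
    · exact ⟨∅, isClopen_empty, Subset.rfl, ContinuousMap.const Q (hne e₀).choose, by simp⟩
    · rintro s t hst ⟨W, hW, htW, hg⟩
      exact ⟨W, hW, hst.trans htW, hg⟩
    · rintro s t ⟨W, hW, hsW, g, hg⟩ ⟨V, hV, htV, k, hk⟩
      classical
      refine ⟨W ∪ V, hW.union hV, union_subset_union hsW htV,
        ⟨W.piecewise g k, continuous_piecewise (by simp [hW.frontier_eq])
          g.continuous.continuousOn k.continuous.continuousOn⟩, ?_⟩
      intro e he
      by_cases heW : e ∈ W
      · simpa [heW] using hg e heW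
      · simpa [heW] using hk e (he.resolve_left heW)
    · intro e _
      obtain ⟨y, hy⟩ := hne e
      have hopen : IsOpen {e' : Q | (e', y) ∈ G} := hG.preimage (by fun_prop)
      obtain ⟨W, hW, heW, hWs⟩ := hQ.exists_subset_of_mem_open hy hopen
      exact ⟨W, mem_nhdsWithin_of_mem_nhds (IsClopen.isOpen hW |>.mem_nhds heW), W, hW, Subset.rfl,
        ContinuousMap.const Q y, fun e' he' => hWs he'⟩
  obtain ⟨W, -, hW, g, hg⟩ := main
  exact ⟨g, fun e => hg e (hW (mem_univ e))⟩

/-- For a continuous family of measures over a compact zero-dimensional space, the level of a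
continuous function can be chosen continuously so that all the level sets are null. By upper
semicontinuity the levels whose level sets have mass less than `1 / (n + 1)` form an open set of
functions, which is dense because it is so locally; Baire's theorem applies. -/
theorem exists_continuous_level_measure_eq_zero {Q X : Type*} [TopologicalSpace Q]
    [CompactSpace Q] [T2Space Q] [TopologicalSpace X] [TopologicalSpace.PseudoMetrizableSpace X]
    [SecondCountableTopology X] [MeasurableSpace X] [BorelSpace X] (hQ : IsZeroDimensional Q)
    {P : Q → ProbabilityMeasure X} (hP : Continuous P) (f : C(X, ℝ)) {s t : ℝ} (hst : s < t) :
    ∃ τ : C(Q, ℝ), (∀ e, τ e ∈ Ioo s t) ∧ ∀ e, (P e : Measure X) {x | f x = τ e} = 0 := by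
  let O : ℕ → Set C(Q, ℝ) := fun n =>
    {τ | ∀ e, (P e : Measure X) {x | f x = τ e} < ((n : ℝ≥0∞) + 1)⁻¹}
  have hO : ∀ n, IsOpen (O n) := by
    intro n
    let j : C(Q, ℝ) → C(Q, Q × ℝ) := fun τ => (ContinuousMap.id Q).prodMk τ
    have hj : Continuous j := ContinuousMap.continuous_of_continuous_uncurry j
      (show Continuous fun p : C(Q, ℝ) × Q => (p.2, p.1 p.2) by fun_prop)
    have := (ContinuousMap.isOpen_setOfPred_mapsTo (isCompact_univ (X := Q))
      (isOpen_setOf_measure_level_lt hP f ((n : ℝ≥0∞) + 1)⁻¹)).preimage hj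
    convert! this using 1
    ext τ
    simp [O, j, MapsTo]
  have hD : ∀ n, Dense (O n) := by
    intro n
    rw [Metric.dense_iff]
    intro τ ε hε
    obtain ⟨g, hg⟩ := exists_continuousMap_graph_subset hQ
      (G := {p : Q × ℝ | (P p.1 : Measure X) {x | f x = p.2} < ((n : ℝ≥0∞) + 1)⁻¹} ∩
        {p : Q × ℝ | dist p.2 (τ p.1) < ε})
      ((isOpen_setOf_measure_level_lt hP f _).inter (isOpen_lt (by fun_prop) (by fun_prop))) <| by
        intro e
        obtain ⟨c, hc, hc0⟩ := exists_level_measure_eq_zero (P e : Measure X)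
          f.continuous.measurable (show τ e - ε < τ e + ε by linarith)
        refine ⟨c, ?_, ?_⟩
        · simp [hc0]
        · simp only [mem_ofPred_eq, Real.dist_eq, abs_lt]
          constructor <;> linarith [hc.1, hc.2]
    exact ⟨g, (ContinuousMap.dist_lt_iff hε).2 fun e => (hg e).2, fun e => (hg e).1⟩
  obtain ⟨τ, hτ, hball⟩ := (dense_iInter_of_isOpen_nat hO hD).inter_open_nonempty
    (Metric.ball (ContinuousMap.const Q ((s + t) / 2)) ((t - s) / 2)) Metric.isOpen_ball
    ⟨_, Metric.mem_ball_self (by linarith)⟩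
  refine ⟨τ, fun e => ?_, fun e => ?_⟩
  · have := (ContinuousMap.dist_lt_iff (by linarith)).1 hτ e
    simp only [ContinuousMap.const_apply, Real.dist_eq, abs_lt] at this
    constructor <;> linarith [this.1, this.2]
  · refine le_antisymm (le_of_forall_gt fun c hc => ?_) bot_le
    obtain ⟨n, hn⟩ := ENNReal.exists_inv_nat_lt hc.ne'
    refine ((mem_iInter.1 hball n) e).trans (lt_of_le_of_lt ?_ hn)
    exact ENNReal.inv_le_inv.2 le_self_add

/-! ### Recovering an ergodic measure from its points -/

theorem continuous_birkhoffAverage {X : Type*} [TopologicalSpace X] {T : X → X}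
    (hT : Continuous T) {h : X → ℝ} (hh : Continuous h) (n : ℕ) :
    Continuous (birkhoffAverage ℝ T h n) := by
  unfold birkhoffAverage birkhoffSum
  exact (continuous_finsetSum _ fun k _ => hh.comp (hT.iterate k)).const_smul ((n : ℝ)⁻¹)

section MeanErgodic

variable {X : Type*} [MeasurableSpace X] {μ : Measure X} {T : X → X} {h : X → ℝ}

theorem memLp_birkhoffSum {p : ℝ≥0∞} (hT : MeasurePreserving T μ μ) (hh : MemLp h p μ) (n : ℕ) :
    MemLp (birkhoffSum T h n) p μ := by
  have : birkhoffSum T h n = fun x => ∑ k ∈ Finset.range n, (h ∘ T^[k]) x := rfl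
  rw [this]
  exact memLp_finsetSum _ fun k _ => hh.comp_measurePreserving (hT.iterate k)

theorem memLp_birkhoffAverage {p : ℝ≥0∞} (hT : MeasurePreserving T μ μ) (hh : MemLp h p μ)
    (n : ℕ) : MemLp (birkhoffAverage ℝ T h n) p μ :=
  (memLp_birkhoffSum hT hh n).const_smul ((n : ℝ)⁻¹)

theorem integral_birkhoffAverage (hT : MeasurePreserving T μ μ) (hh : Integrable h μ) {n : ℕ}
    (hn : n ≠ 0) : ∫ x, birkhoffAverage ℝ T h n x ∂μ = ∫ x, h x ∂μ := by
  have hk : ∀ k, ∫ x, h (T^[k] x) ∂μ = ∫ x, h x ∂μ := fun k =>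
    (integral_map (hT.iterate k).measurable.aemeasurable
      (by rw [(hT.iterate k).map_eq]; exact hh.1)).symm.trans (by rw [(hT.iterate k).map_eq])
  simp only [birkhoffAverage, birkhoffSum, smul_eq_mul]
  have hi : ∀ k ∈ Finset.range n, Integrable (fun x => h (T^[k] x)) μ := fun k _ =>
    (hT.iterate k).integrable_comp_of_integrable hh
  rw [integral_const_mul, integral_finsetSum _ hi]
  simp only [hk, Finset.sum_const, Finset.card_range, nsmul_eq_mul]
  field_simp

theorem integral_sub_const_sq [IsProbabilityMeasure μ] {A : X → ℝ} (hA : MemLp A 2 μ) (a : ℝ) :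
    ∫ x, (A x - a) ^ 2 ∂μ = ∫ x, A x ^ 2 ∂μ - 2 * a * ∫ x, A x ∂μ + a ^ 2 := by
  have hi := hA.integrable (q := 2) (by norm_num)
  simp only [sub_sq]
  rw [integral_add, integral_sub hA.integrable_sq]
  · simp only [mul_right_comm 2 _ a, integral_const_mul, integral_const, probReal_univ, one_smul]
  · exact (hi.const_mul 2).mul_const a
  · exact hA.integrable_sq.sub ((hi.const_mul 2).mul_const a)
  · exact integrable_const _

/-- The mean ergodic theorem for an ergodic map: the variance of the Birkhoff averages tends to
zero. -/
theorem Ergodic.tendsto_integral_birkhoffAverage_sub_sq [IsProbabilityMeasure μ]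
    (hT : Ergodic T μ) (hh : MemLp h 2 μ) :
    Tendsto (fun n => ∫ x, (birkhoffAverage ℝ T h n x - ∫ y, h y ∂μ) ^ 2 ∂μ) atTop (𝓝 0) := by
  have hT' := hT.toMeasurePreserving
  let U : Lp ℝ 2 μ →L[ℝ] Lp ℝ 2 μ := (Lp.compMeasurePreservingₗᵢ ℝ T hT').toContinuousLinearMap
  have hU : ‖U‖ ≤ 1 := LinearIsometry.norm_toContinuousLinearMap_le _
  have hiter : ∀ n, U^[n] (hh.toLp h) =
      (hh.comp_measurePreserving (hT'.iterate n)).toLp (h ∘ T^[n]) := by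
    intro n
    induction n with
    | zero => rfl
    | succ n ih =>
      rw [Function.iterate_succ_apply', ih]
      rfl
  have hsum : ∀ n, birkhoffSum U id n (hh.toLp h) =
      (memLp_birkhoffSum hT' hh n).toLp (birkhoffSum T h n) := by
    intro n
    induction n with
    | zero =>
      rw [birkhoffSum_zero]
      exact (MemLp.toLp_zero _).symm
    | succ n ih =>
      rw [birkhoffSum_succ, ih, id, hiter, ← MemLp.toLp_add]
      refine MemLp.toLp_congr _ _ (Eventually.of_forall fun x => ?_)
      simp [birkhoffSum_succ]
  have havg : ∀ n, birkhoffAverage ℝ U id n (hh.toLp h) =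
      (memLp_birkhoffAverage hT' hh n).toLp (birkhoffAverage ℝ T h n) := by
    intro n
    rw [birkhoffAverage, hsum]
    rfl
  have hlim := U.tendsto_birkhoffAverage_orthogonalProjection hU (hh.toLp h)
  generalize (U.eqLocus (1 : Lp ℝ 2 μ →L[ℝ] Lp ℝ 2 μ)).orthogonalProjectionOnto (hh.toLp h) = y'
    at hlim
  obtain ⟨y, hy⟩ := y'
  simp only [havg] at hlim
  -- The limit is an invariant function, hence a constant `c`.
  have hyT : y ∘ T =ᵐ[μ] y := by
    have h1 : Lp.compMeasurePreserving T hT' y = y := hy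
    have h2 := Lp.coeFn_compMeasurePreserving y hT'
    rw [h1] at h2
    exact h2.symm
  obtain ⟨c, hc⟩ := hT.ae_eq_const_of_ae_eq_comp_ae (Lp.aestronglyMeasurable y) hyT
  have hnorm : ∀ n, ‖(memLp_birkhoffAverage hT' hh n).toLp (birkhoffAverage ℝ T h n) - y‖ ^ 2 =
      ∫ x, (birkhoffAverage ℝ T h n x - c) ^ 2 ∂μ := by
    intro n
    rw [← real_inner_self_eq_norm_sq, L2.inner_def]
    refine integral_congr_ae ?_
    filter_upwards [Lp.coeFn_sub ((memLp_birkhoffAverage hT' hh n).toLp _) y,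
      (memLp_birkhoffAverage hT' hh n).coeFn_toLp, hc] with x h1 h2 h3
    rw [h1, Pi.sub_apply, h2, h3]
    simp [sq]
  have hlim2 : Tendsto (fun n => ∫ x, (birkhoffAverage ℝ T h n x - c) ^ 2 ∂μ) atTop (𝓝 0) := by
    simp only [← hnorm]
    simpa using ((tendsto_iff_norm_sub_tendsto_zero.1 hlim).pow 2)
  -- Replacing `c` by the mean of the averages only decreases the second moment.
  refine squeeze_zero' (Eventually.of_forall fun n => integral_nonneg fun x => sq_nonneg _) ?_ hlim2
  filter_upwards [eventually_ne_atTop 0] with n hn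
  have hA := memLp_birkhoffAverage hT' hh n
  have hmean := integral_birkhoffAverage hT' (hh.integrable (by norm_num)) hn
  set m := ∫ y, h y ∂μ
  rw [integral_sub_const_sq hA, integral_sub_const_sq hA, hmean]
  nlinarith [sq_nonneg (c - m)]

/-- Doubling the length of the Birkhoff averages does not increase their second moments about a
given point. -/
theorem integral_birkhoffAverage_sub_sq_add_self_le [IsFiniteMeasure μ]
    (hT : MeasurePreserving T μ μ) (hh : MemLp h 2 μ) (m : ℝ) (n : ℕ) :
    ∫ x, (birkhoffAverage ℝ T h (n + n) x - m) ^ 2 ∂μ ≤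
      ∫ x, (birkhoffAverage ℝ T h n x - m) ^ 2 ∂μ := by
  have hAm : MemLp (fun x => birkhoffAverage ℝ T h n x - m) 2 μ :=
    (memLp_birkhoffAverage hT hh n).sub (memLp_const m)
  have hu := hAm.integrable_sq
  have hTn := hT.iterate n
  have huT : Integrable (fun x => (birkhoffAverage ℝ T h n (T^[n] x) - m) ^ 2) μ :=
    hTn.integrable_comp_of_integrable hu
  have hinv : ∫ x, (birkhoffAverage ℝ T h n (T^[n] x) - m) ^ 2 ∂μ =
      ∫ x, (birkhoffAverage ℝ T h n x - m) ^ 2 ∂μ := by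
    have := integral_map (μ := μ) (φ := T^[n]) hTn.measurable.aemeasurable
      (f := fun x => (birkhoffAverage ℝ T h n x - m) ^ 2) (by rw [hTn.map_eq]; exact hu.1)
    rw [← this, hTn.map_eq]
  have hdouble : ∀ x, birkhoffAverage ℝ T h (n + n) x =
      (birkhoffAverage ℝ T h n x + birkhoffAverage ℝ T h n (T^[n] x)) / 2 := by
    intro x
    simp only [birkhoffAverage, birkhoffSum_add, smul_eq_mul, Nat.cast_add]
    rcases eq_or_ne (n : ℝ) 0 with h0 | h0
    · simp [h0]
    · field_simp
      ring
  calc ∫ x, (birkhoffAverage ℝ T h (n + n) x - m) ^ 2 ∂μ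
      ≤ ∫ x, (((birkhoffAverage ℝ T h n x - m) ^ 2 +
          (birkhoffAverage ℝ T h n (T^[n] x) - m) ^ 2) / 2) ∂μ := by
        refine integral_mono_of_nonneg (Eventually.of_forall fun x => sq_nonneg _)
          ((hu.add huT).div_const 2) (Eventually.of_forall fun x => ?_)
        simp only [hdouble]
        nlinarith [sq_nonneg (birkhoffAverage ℝ T h n x - birkhoffAverage ℝ T h n (T^[n] x))]
    _ = ∫ x, (birkhoffAverage ℝ T h n x - m) ^ 2 ∂μ := by
        rw [integral_div, integral_add hu huT, hinv]
        ring

end MeanErgodic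

section Selector

theorem ContinuousMap.memLp_of_isFiniteMeasure {X : Type*} [TopologicalSpace X] [CompactSpace X]
    [MeasurableSpace X] [OpensMeasurableSpace X] (h : C(X, ℝ))
    (μ : Measure X) [IsFiniteMeasure μ] (p : ℝ≥0∞) : MemLp h p μ :=
  MemLp.of_bound h.continuous.aestronglyMeasurable ‖h‖ (Eventually.of_forall h.norm_coe_le_norm)

theorem ContinuousMap.continuous_integral {X : Type*} [TopologicalSpace X] [CompactSpace X]
    [MeasurableSpace X] [OpensMeasurableSpace X] (μ : Measure X) [IsFiniteMeasure μ] :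
    Continuous fun h : C(X, ℝ) => ∫ x, h x ∂μ := by
  have hi : ∀ h : C(X, ℝ), Integrable h μ := fun h =>
    (h.memLp_of_isFiniteMeasure μ 1).integrable le_rfl
  refine (LipschitzWith.of_dist_le_mul (K := μ.real univ |>.toNNReal) fun f g => ?_).continuous
  rw [dist_eq_norm, ← integral_sub (hi f) (hi g), Real.coe_toNNReal _ measureReal_nonneg, mul_comm]
  exact norm_integral_le_of_norm_le_const (Eventually.of_forall fun x => by
    simpa [dist_eq_norm] using ContinuousMap.dist_apply_le_dist (f := f) (g := g) x)


variable {Q X : Type*} [TopologicalSpace Q] [CompactSpace Q]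
  [TopologicalSpace X] [CompactSpace X] [MeasurableSpace X] [BorelSpace X]
  {P : Q → ProbabilityMeasure X} {T : X → X}

/-- For a compact family of ergodic measures, the mean ergodic theorem holds uniformly along powers
of two, by Dini's theorem. -/
theorem tendstoUniformly_integral_birkhoffAverage_sub_sq (hP : Continuous P) (hT : Continuous T)
    (herg : ∀ e, Ergodic T (P e : Measure X)) (h : C(X, ℝ)) :
    TendstoUniformly (fun (k : ℕ) e => ∫ x, (birkhoffAverage ℝ T h (2 ^ k) x -
      ∫ y, h y ∂(P e : Measure X)) ^ 2 ∂(P e : Measure X)) (fun _ => 0) atTop := by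
  have hint : ∀ g : X → ℝ, Continuous g → Continuous fun e => ∫ x, g x ∂(P e : Measure X) :=
    fun g hg => ProbabilityMeasure.continuous_iff_forall_continuousMap_continuous_integral.1 hP
      ⟨g, hg⟩
  refine Antitone.tendstoUniformly_of_forall_tendsto (fun k => ?_) ?_ continuous_const fun e => ?_
  · have hA := continuous_birkhoffAverage hT h.continuous (2 ^ k)
    have hexp : ∀ e, ∫ x, (birkhoffAverage ℝ T h (2 ^ k) x -
        ∫ y, h y ∂(P e : Measure X)) ^ 2 ∂(P e : Measure X) =
        ∫ x, birkhoffAverage ℝ T h (2 ^ k) x ^ 2 ∂(P e : Measure X) -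
          (∫ y, h y ∂(P e : Measure X)) ^ 2 := by
      intro e
      have hAi := memLp_birkhoffAverage (herg e).toMeasurePreserving
        (h.memLp_of_isFiniteMeasure (P e : Measure X) 2) (2 ^ k)
      have hmean := integral_birkhoffAverage (herg e).toMeasurePreserving
        ((h.memLp_of_isFiniteMeasure (P e : Measure X) 1).integrable le_rfl)
        (pow_ne_zero k two_ne_zero)
      rw [integral_sub_const_sq hAi, hmean]
      ring
    simp only [hexp]
    exact (hint _ (hA.pow 2)).sub ((hint _ h.continuous).pow 2)
  · refine antitone_nat_of_succ_le fun k e => ?_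
    rw [pow_succ, mul_two]
    exact integral_birkhoffAverage_sub_sq_add_self_le (herg e).toMeasurePreserving
      (h.memLp_of_isFiniteMeasure _ 2) _ _
  · exact ((herg e).tendsto_integral_birkhoffAverage_sub_sq
      (h.memLp_of_isFiniteMeasure _ 2)).comp (tendsto_pow_atTop_atTop_of_one_lt one_lt_two)

/-- For a compact family of ergodic measures, one Borel function computes the integral of `h`
against each of the measures, at almost every point for that measure. It is a limit of Birkhoff
averages along a sequence that makes their variances summable for all the measures at once. -/
theorem exists_measurable_ae_eq_integral (hP : Continuous P) (hT : Continuous T)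
    (herg : ∀ e, Ergodic T (P e : Measure X)) (h : C(X, ℝ)) :
    ∃ ℓ : X → ℝ, Measurable ℓ ∧
      ∀ e, ∀ᵐ x ∂(P e : Measure X), ℓ x = ∫ y, h y ∂(P e : Measure X) := by
  have hunif := tendstoUniformly_integral_birkhoffAverage_sub_sq hP hT herg h
  have hex : ∀ j : ℕ, ∃ n : ℕ, ∀ e, ∫ x, (birkhoffAverage ℝ T h n x -
      ∫ y, h y ∂(P e : Measure X)) ^ 2 ∂(P e : Measure X) < (1 / 2 : ℝ) ^ j := by
    intro j
    obtain ⟨k, hk⟩ := (Metric.tendstoUniformly_iff.1 hunif _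
      (show (0 : ℝ) < (1 / 2) ^ j by positivity)).exists
    refine ⟨2 ^ k, fun e => lt_of_abs_lt ?_⟩
    simpa [Real.dist_eq] using hk e
  choose n hn using hex
  have hmeas : ∀ j, Measurable (birkhoffAverage ℝ T h (n j)) := fun j =>
    (continuous_birkhoffAverage hT h.continuous (n j)).measurable
  refine ⟨fun x => limsup (fun j => birkhoffAverage ℝ T h (n j) x) atTop,
    Measurable.limsup hmeas, fun e => ?_⟩
  set m := ∫ y, h y ∂(P e : Measure X) with hm
  have hsum : ∫⁻ x, ∑' j, ENNReal.ofReal ((birkhoffAverage ℝ T h (n j) x - m) ^ 2)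
      ∂(P e : Measure X) ≠ ∞ := by
    rw [lintegral_tsum fun j => by have := hmeas j; fun_prop]
    refine ne_top_of_le_ne_top ?_ (ENNReal.tsum_le_tsum fun j =>
      (?_ : _ ≤ ENNReal.ofReal ((1 / 2 : ℝ) ^ j)))
    · rw [← ENNReal.ofReal_tsum_of_nonneg (fun j => by positivity) summable_geometric_two]
      exact ENNReal.ofReal_ne_top
    · have hA : MemLp (fun x => birkhoffAverage ℝ T h (n j) x - m) 2 (P e : Measure X) :=
        (memLp_birkhoffAverage (herg e).toMeasurePreserving
          (h.memLp_of_isFiniteMeasure _ 2) _).sub (memLp_const m)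
      rw [← ofReal_integral_eq_lintegral_ofReal hA.integrable_sq
        (Eventually.of_forall fun x => sq_nonneg _)]
      exact ENNReal.ofReal_le_ofReal (hn j e).le
  filter_upwards [ae_lt_top' (AEMeasurable.tsum fun j => by have := hmeas j; fun_prop)
    hsum] with x hx
  have h0 := ENNReal.tendsto_atTop_zero_of_tsum_ne_top hx.ne
  have h1 : Tendsto (fun j => (birkhoffAverage ℝ T h (n j) x - m) ^ 2) atTop (𝓝 0) := by
    have := (ENNReal.tendsto_toReal ENNReal.zero_ne_top).comp h0
    simpa [Function.comp_def, ENNReal.toReal_ofReal (sq_nonneg _)] using this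
  have h2 : Tendsto (fun j => birkhoffAverage ℝ T h (n j) x - m) atTop (𝓝 0) := by
    refine (tendsto_zero_iff_abs_tendsto_zero _).2 ?_
    have := (Real.continuous_sqrt.tendsto 0).comp h1
    simpa [Function.comp_def, Real.sqrt_sq_eq_abs] using this
  have h3 : Tendsto (fun j => birkhoffAverage ℝ T h (n j) x) atTop (𝓝 m) := by
    simpa using h2.add_const m
  exact h3.limsup_eq

/-- A continuous injective family of ergodic measures over a compact space can be recovered from
points: a Borel map sends almost every point for the measure `P e` to `e`. -/
theorem exists_measurable_ae_eq_index [TopologicalSpace.MetrizableSpace X] [Nonempty Q]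
    [MeasurableSpace Q] [BorelSpace Q]
    (hP : Continuous P) (hinj : Function.Injective P) (hT : Continuous T)
    (herg : ∀ e, Ergodic T (P e : Measure X)) :
    ∃ q : X → Q, Measurable q ∧ ∀ e, ∀ᵐ x ∂(P e : Measure X), q x = e := by
  choose ℓ hℓm hℓ using fun h => exists_measurable_ae_eq_integral hP hT herg h
  let d : ℕ → C(X, ℝ) := TopologicalSpace.denseSeq C(X, ℝ)
  let J : Q → ℕ → ℝ := fun e j => ∫ y, d j y ∂(P e : Measure X)
  have hJc : Continuous J := continuous_pi fun j =>
    ProbabilityMeasure.continuous_iff_forall_continuousMap_continuous_integral.1 hP (d j)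
  have hJi : Function.Injective J := by
    intro e e' hee
    refine hinj (ProbabilityMeasure.toMeasure_injective
      (ext_of_forall_integral_eq_of_IsFiniteMeasure fun f => ?_))
    have := (TopologicalSpace.denseRange_denseSeq C(X, ℝ)).equalizer 
      (ContinuousMap.continuous_integral (P e : Measure X))
      (ContinuousMap.continuous_integral (P e' : Measure X))
      (funext fun j => congrFun hee j)
    exact congrFun this f.toContinuousMap
  have hemb : MeasurableEmbedding J := (hJc.isClosedEmbedding hJi).measurableEmbedding
  obtain ⟨r, hr, hrJ⟩ := hemb.exists_measurable_extend measurable_id fun _ => inferInstance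
  refine ⟨fun x => r fun j => ℓ (d j) x, hr.comp (measurable_pi_lambda _ fun j => hℓm _),
    fun e => ?_⟩
  filter_upwards [ae_all_iff.2 fun j => hℓ (d j) e] with x hx
  have : (fun j => ℓ (d j) x) = J e := funext hx
  rw [this]
  exact congrFun hrJ e

end Selector

/-! ### Symbolic coding -/

/-- The two-sided shift on the sequences indexed by `ℤ` with entries in `ι → Bool`. -/
def shiftHomeomorph (ι : Type*) : (ι × ℤ → Bool) ≃ₜ (ι × ℤ → Bool) where
  toFun z := fun i => z (i.1, i.2 + 1)
  invFun z := fun i => z (i.1, i.2 - 1)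
  left_inv z := by simp
  right_inv z := by simp

/-- The two-sided shift as a topological dynamical system, for some metric inducing the product
topology. -/
noncomputable def shiftSystem (ι : Type) [Countable ι] : TopSystem.{0} where
  carrier := ι × ℤ → Bool
  metric := TopologicalSpace.metrizableSpaceMetric _
  compact := inferInstanceAs (CompactSpace (ι × ℤ → Bool))
  T := shiftHomeomorph ι

theorem isZeroDimensional_shiftSystem (ι : Type) [Countable ι] :
    IsZeroDimensional (shiftSystem ι).carrier :=
  isTopologicalBasis_isClopen (X := ι × ℤ → Bool)

theorem measurable_shiftSystem {Y : Type*} [MeasurableSpace Y] (ι : Type) [Countable ι]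
    {φ : Y → (shiftSystem ι).carrier}
    (hφ : ∀ i, Measurable fun y => (show ι × ℤ → Bool from φ y) i) : Measurable φ := by
  have h : @Measurable Y (ι × ℤ → Bool) _ MeasurableSpace.pi φ := measurable_pi_lambda _ hφ
  exact h.mono le_rfl (BorelSpace.measurable_eq (α := ι × ℤ → Bool)).ge

/-- A map to sequences that is given by strict inequalities between continuous functions is
continuous where none of them is an equality. -/
theorem continuousAt_decide_lt {Y ι : Type*} [TopologicalSpace Y] {a b : ι → Y → ℝ}
    (ha : ∀ i, Continuous (a i)) (hb : ∀ i, Continuous (b i)) {y : Y} (h : ∀ i, a i y ≠ b i y) :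
    ContinuousAt (fun y i => decide (a i y < b i y)) y := by
  refine continuousAt_pi.2 fun i => ?_
  refine ContinuousAt.congr (f := fun _ => decide (a i y < b i y)) continuousAt_const ?_
  rcases (h i).lt_or_gt with hlt | hlt
  · filter_upwards [(isOpen_lt (ha i) (hb i)).mem_nhds hlt] with z hz
    rw [decide_eq_true hlt, decide_eq_true (show a i z < b i z from hz)]
  · filter_upwards [(isOpen_lt (hb i) (ha i)).mem_nhds hlt] with z hz
    rw [decide_eq_false hlt.not_gt, decide_eq_false (show ¬ a i z < b i z from lt_asymm hz)]

/-- For a continuous family of invariant measures over a compact zero-dimensional space `Q`, there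
is a Borel coding of `Q × X` by a zero-dimensional system that is equivariant, separates the points
of `X`, and is continuous almost everywhere. The symbols record on which side of a level `τ e`
the values of the distance to a point of a dense sequence lie. -/
theorem exists_coding {Q X : Type*} [TopologicalSpace Q] [CompactSpace Q] [T2Space Q]
    [SecondCountableTopology Q] [MeasurableSpace Q] [BorelSpace Q]
    [MetricSpace X] [CompactSpace X] [MeasurableSpace X] [BorelSpace X]
    (hQ : IsZeroDimensional Q) {P : Q → ProbabilityMeasure X} (hP : Continuous P) (T : X ≃ₜ X)
    (hT : ∀ e, MeasurePreserving T (P e : Measure X) (P e : Measure X)) :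
    ∃ (Z : TopSystem.{0}) (φ : Q × X → Z.carrier), IsZeroDimensional Z.carrier ∧ Measurable φ ∧
      (∀ e x, φ (e, T x) = Z.T (φ (e, x))) ∧ (∀ e x e' x', φ (e, x) = φ (e', x') → x = x') ∧
      ∀ e, ∀ᵐ x ∂(P e : Measure X), ContinuousAt φ (e, x) := by
  have hTn : ∀ (n : ℤ) e, MeasurePreserving (T ^ n : X ≃ₜ X) (P e : Measure X) (P e) := by
    have hnat : ∀ (n : ℕ) e, MeasurePreserving (T ^ n : X ≃ₜ X) (P e : Measure X) (P e) := by
      intro n e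
      induction n with
      | zero => exact MeasurePreserving.id _
      | succ n ih =>
        rw [pow_succ]
        exact ih.comp (hT e)
    intro n e
    cases n with
    | ofNat n => simpa using hnat n e
    | negSucc n =>
      rw [zpow_negSucc]
      exact (hnat (n + 1) e).symm (T ^ (n + 1) : X ≃ₜ X).toMeasurableEquiv
  rcases isEmpty_or_nonempty X with hX | hX
  · refine ⟨shiftSystem Empty, fun y => (hX.false y.2).elim, isZeroDimensional_shiftSystem _,
      measurable_of_empty _, fun e x => (hX.false x).elim, fun e x => (hX.false x).elim,
      fun e => Eventually.of_forall fun x => (hX.false x).elim⟩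
  let ι : Type := {i : ℕ × ℚ × ℚ // i.2.1 < i.2.2}
  let f : ι → C(X, ℝ) := fun i =>
    ⟨fun x => dist x (TopologicalSpace.denseSeq X i.1.1), by fun_prop⟩
  choose τ hτ hτ0 using fun i : ι =>
    exists_continuous_level_measure_eq_zero hQ hP (f i) (Rat.cast_lt (K := ℝ).2 i.2)
  let a : ι × ℤ → Q × X → ℝ := fun i y => τ i.1 y.1
  let b : ι × ℤ → Q × X → ℝ := fun i y => f i.1 ((T ^ i.2 : X ≃ₜ X) y.2)
  have ha : ∀ i, Continuous (a i) := fun i => by fun_prop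
  have hb : ∀ i, Continuous (b i) := fun i =>
    (f i.1).continuous.comp ((T ^ i.2 : X ≃ₜ X).continuous.comp continuous_snd)
  let φ : Q × X → (shiftSystem ι).carrier := fun y i => decide (a i y < b i y)
  refine ⟨shiftSystem ι, φ, isZeroDimensional_shiftSystem ι, ?_, ?_, ?_, ?_⟩
  · refine measurable_shiftSystem ι fun i => ?_
    exact measurable_to_bool (by
      simpa [preimage, φ] using measurableSet_lt (ha i).measurable (hb i).measurable)
  · intro e x
    funext i
    change decide (τ i.1 e < f i.1 ((T ^ i.2 : X ≃ₜ X) (T x))) =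
      decide (τ i.1 e < f i.1 ((T ^ (i.2 + 1) : X ≃ₜ X) x))
    rw [zpow_add_one]
    rfl
  · intro e x e' x' h
    by_contra hne
    -- A rational interval separates the distances of `x` and `x'` to a nearby point.
    have hd : 0 < dist x' x / 2 := half_pos (dist_pos.2 (Ne.symm hne))
    obtain ⟨j, hj⟩ := (TopologicalSpace.denseRange_denseSeq X).exists_dist_lt x hd
    have hlt : dist x (TopologicalSpace.denseSeq X j) <
        dist x' (TopologicalSpace.denseSeq X j) := by
      linarith [dist_triangle_right x' x (TopologicalSpace.denseSeq X j)]
    obtain ⟨s, hs1, hs2⟩ := exists_rat_btwn hlt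
    obtain ⟨t, ht1, ht2⟩ := exists_rat_btwn hs2
    let i : ι := ⟨(j, s, t), Rat.cast_lt.1 ht1⟩
    have hi : decide (τ i e < f i x) = decide (τ i e' < f i x') := congrFun h (i, 0)
    have h1 : ¬ τ i e < f i x := not_lt.2 (hs1.trans (hτ i e).1).le
    have h2 : τ i e' < f i x' := (hτ i e').2.trans ht2
    simp [h1, h2] at hi
  · intro e
    have hall : ∀ᵐ x ∂(P e : Measure X), ∀ i : ι × ℤ, a i (e, x) ≠ b i (e, x) := by
      refine ae_all_iff.2 fun i => ?_
      have h0 : ∀ᵐ x ∂(P e : Measure X), f i.1 x ≠ τ i.1 e := by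
        simpa [ae_iff] using hτ0 i.1 e
      filter_upwards [(hTn i.2 e).quasiMeasurePreserving.ae h0] with x hx
      exact hx.symm
    filter_upwards [hall] with x hx
    exact continuousAt_decide_lt ha hb hx

/-! ### Disjoint integrals of a continuous family of measures -/

section Kernel

variable {Q X : Type*} [TopologicalSpace Q] [MeasurableSpace Q] [BorelSpace Q]
  [TopologicalSpace X] [TopologicalSpace.PseudoMetrizableSpace X]
  [MeasurableSpace X] [BorelSpace X]

theorem measurable_toMeasure_of_continuous {P : Q → ProbabilityMeasure X} (hP : Continuous P) :
    Measurable fun e => (P e : Measure X) := by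
  refine Measurable.measure_of_isPiSystem_of_isProbabilityMeasure
    (BorelSpace.measurable_eq (α := X)) isPiSystem_isOpen fun G hG => ?_
  refine LowerSemicontinuous.measurable fun e => ?_
  refine lowerSemicontinuousAt_iff_le_liminf.2 ?_
  exact ProbabilityMeasure.le_liminf_measure_open_of_tendsto (hP.tendsto e) hG

/-- A continuous family of probability measures as a Markov kernel. -/
def kernelOfContinuous (P : Q → ProbabilityMeasure X) (hP : Continuous P) : Kernel Q X where
  toFun e := P e
  measurable' := measurable_toMeasure_of_continuous hP

instance (P : Q → ProbabilityMeasure X) (hP : Continuous P) :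
    IsMarkovKernel (kernelOfContinuous P hP) :=
  ⟨fun e => inferInstanceAs (IsProbabilityMeasure (P e : Measure X))⟩

/-- The integral over `ξ` of the measures `P e`, each of them placed on the fibre over `e`. -/
noncomputable def fibredIntegral (P : Q → ProbabilityMeasure X) (hP : Continuous P)
    (ξ : ProbabilityMeasure Q) : ProbabilityMeasure (Q × X) :=
  ⟨(ξ : Measure Q) ⊗ₘ kernelOfContinuous P hP, inferInstance⟩

variable {P : Q → ProbabilityMeasure X} {hP : Continuous P}

theorem ae_fibredIntegral {ξ : ProbabilityMeasure Q} {p : Q × X → Prop}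
    (hp : MeasurableSet {z | p z}) (h : ∀ e, ∀ᵐ x ∂(P e : Measure X), p (e, x)) :
    ∀ᵐ z ∂(fibredIntegral P hP ξ : Measure (Q × X)), p z :=
  Measure.ae_compProd_of_ae_ae hp (Eventually.of_forall h)

variable [CompactSpace Q] [TopologicalSpace.MetrizableSpace Q] [CompactSpace X]

theorem integral_fibredIntegral (ξ : ProbabilityMeasure Q) (f : C(Q × X, ℝ)) :
    ∫ z, f z ∂(fibredIntegral P hP ξ : Measure (Q × X)) =
      ∫ e, ∫ x, f (e, x) ∂(P e : Measure X) ∂(ξ : Measure Q) :=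
  Measure.integral_compProd ((f.memLp_of_isFiniteMeasure _ 1).integrable le_rfl)

theorem continuous_fibredIntegral : Continuous (fibredIntegral P hP) := by
  refine ProbabilityMeasure.continuous_iff_forall_continuousMap_continuous_integral.2 fun f => ?_
  simp only [integral_fibredIntegral]
  have hinner : Continuous fun e => ∫ x, f (e, x) ∂(P e : Measure X) := by
    have hδ : Continuous fun e => (diracProba e).prod (P e) :=
      ProbabilityMeasure.continuous_prod.comp (continuous_diracProba.prodMk hP)
    have := ProbabilityMeasure.continuous_iff_forall_continuousMap_continuous_integral.1 hδ f
    refine this.congr fun e => ?_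
    change ∫ z, f z ∂((Measure.dirac e).prod (P e : Measure X)) = _
    rw [Measure.dirac_prod, integral_map (by fun_prop) f.continuous.aestronglyMeasurable]
  exact ProbabilityMeasure.continuous_integral_continuousMap (⟨_, hinner⟩ : C(Q, ℝ))

end Kernel

/-! ### Isomorphic systems -/

theorem MeasureIsomorphic.trans {X Y W : Type*} [MeasurableSpace X] [MeasurableSpace Y]
    [MeasurableSpace W] {μ : Measure X} {T : X → X} {ν : Measure Y} {S : Y → Y} {ρ : Measure W}
    {R : W → W} (h₁ : MeasureIsomorphic μ T ν S) (h₂ : MeasureIsomorphic ν S ρ R) :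
    MeasureIsomorphic μ T ρ R := by
  obtain ⟨φ, ψ, hφ, hψ, hψφ, hφψ, heq⟩ := h₁
  obtain ⟨φ', ψ', hφ', hψ', hψφ', hφψ', heq'⟩ := h₂
  refine ⟨φ' ∘ φ, ψ ∘ ψ', hφ'.comp hφ, hψ.comp hψ', ?_, ?_, ?_⟩
  · filter_upwards [hψφ, hφ.quasiMeasurePreserving.ae hψφ'] with x h1 h2
    simp only [Function.comp_apply, h2, h1]
  · filter_upwards [hφψ', hψ'.quasiMeasurePreserving.ae hφψ] with x h1 h2
    simp only [Function.comp_apply, h2, h1]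
  · filter_upwards [heq, hφ.quasiMeasurePreserving.ae heq'] with x h1 h2
    simp only [Function.comp_apply, h1, h2]

theorem MeasureIsomorphic.ergodic {X Y : Type*} [MeasurableSpace X] [MeasurableSpace Y]
    {μ : Measure X} {T : X → X} {ν : Measure Y} {S : Y → Y} (h : MeasureIsomorphic μ T ν S)
    (hT : Ergodic T μ) (hS : MeasurePreserving S ν ν) : Ergodic S ν := by
  obtain ⟨φ, -, hφ, -, -, -, heq⟩ := h
  refine ⟨hS, ⟨fun s hs hinv => ?_⟩⟩
  have hsets : T ⁻¹' (φ ⁻¹' s) =ᵐ[μ] (φ ⁻¹' s : Set X) := by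
    filter_upwards [heq] with x hx
    change (φ (T x) ∈ s) = (φ x ∈ s)
    rw [hx]
    exact congrArg (φ x ∈ ·) hinv
  have hconst := hT.quasiErgodic.aeconst_set₀ (hφ.measurable hs).nullMeasurableSet hsets
  rw [eventuallyConst_set] at hconst ⊢
  rw [← hφ.map_eq]
  refine hconst.imp (fun h1 => ?_) fun h1 => ?_
  · exact (ae_map_iff hφ.measurable.aemeasurable hs).2 h1
  · exact (ae_map_iff hφ.measurable.aemeasurable hs.compl).2 h1

/-- An injective Borel map that intertwines two systems almost everywhere is an isomorphism onto
the push-forward. -/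
theorem MeasureIsomorphic.map_of_injective {X Y : Type*} [MeasurableSpace X] [StandardBorelSpace X]
    [MeasurableSpace Y] [StandardBorelSpace Y] [Nonempty X] {μ : Measure X} {T : X → X}
    {S : Y → Y} {ψ : X → Y} (hψ : Measurable ψ) (hinj : Function.Injective ψ)
    (heq : ∀ᵐ x ∂μ, ψ (T x) = S (ψ x)) : MeasureIsomorphic μ T (μ.map ψ) S := by
  have hemb := hψ.measurableEmbedding hinj
  obtain ⟨r, hr, hrψ⟩ := hemb.exists_measurable_extend measurable_id fun _ => inferInstance
  have hrψ' : ∀ x, r (ψ x) = x := congrFun hrψ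
  refine ⟨ψ, r, ⟨hψ, rfl⟩, ⟨hr, ?_⟩, Eventually.of_forall hrψ', ?_, heq⟩
  · rw [Measure.map_map hr hψ, hrψ, Measure.map_id]
  · exact hemb.ae_map_iff.2 (Eventually.of_forall fun x => congrArg ψ (hrψ' x))

/-! ### Faces of the simplex of invariant measures -/

theorem TopSystem.mem_extremePoints_of_ergodic (S : TopSystem.{u}) {μ : FiniteMeasure S.carrier}
    (hμ : IsProbabilityMeasure (μ : Measure S.carrier))
    (herg : Ergodic S.T (μ : Measure S.carrier)) :
    μ ∈ S.invariantMeasures.extremePoints ℝ≥0 := by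
  refine ⟨⟨hμ, herg.toMeasurePreserving⟩, ?_⟩
  rintro μ₁ ⟨h₁, hT₁⟩ μ₂ ⟨h₂, hT₂⟩ ⟨a, b, ha, hb, hab, hμab⟩
  refine Subtype.ext (herg.mem_extremePoints.2 ⟨hT₁, h₁⟩ ⟨hT₂, h₂⟩ ?_)
  refine ⟨a, b, by simpa using ha, by simpa using hb, by exact_mod_cast hab, ?_⟩
  rw [← hμab]
  rfl

/-- The image of a compact convex set under a continuous injective affine map to invariant measures
is a face if its extreme points go to ergodic measures. -/
theorem TopSystem.embedsIn_of_continuous_injective {E : Type*} [AddCommGroup E] [Module ℝ E]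
    [TopologicalSpace E] {K : Set E} (hK : IsCompact K) (hKc : Convex ℝ K) {Φ : K → MPSystem.{v}}
    (S : TopSystem.{u}) (ρ : K → FiniteMeasure S.carrier) (hρ : Continuous ρ)
    (hinj : Function.Injective ρ) (haff : IsAffine ρ) (hinv : ∀ p, ρ p ∈ S.invariantMeasures)
    (hiso : ∀ p, (Φ p).Isomorphic (S.naturalAssignment ⟨ρ p, hinv p⟩))
    (herg : ∀ p : K, (p : E) ∈ K.extremePoints ℝ → Ergodic (Φ p).T (Φ p).μ) :
    EmbedsIn Φ S := by
  have : CompactSpace K := isCompact_iff_compactSpace.1 hK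
  have hcomb : ∀ (p q : K) (a b : ℝ≥0), a + b = 1 →
      ∃ r : K, (r : E) = a • (p : E) + b • (q : E) ∧ ρ r = a • ρ p + b • ρ q := by
    intro p q a b hab
    have hmem : a • (p : E) + b • (q : E) ∈ K :=
      hKc p.2 q.2 a.2 b.2 (by exact_mod_cast hab)
    exact ⟨⟨_, hmem⟩, rfl, haff p q ⟨_, hmem⟩ a b hab rfl⟩
  have hF : IsFace (range ρ) S.invariantMeasures := by
    refine ⟨range_subset_iff.2 hinv, isCompact_range hρ, ?_, ?_⟩
    · rintro _ ⟨p, rfl⟩ _ ⟨q, rfl⟩ a b - - hab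
      obtain ⟨r, -, hr⟩ := hcomb p q a b hab
      exact ⟨r, hr⟩
    · rintro _ ⟨⟨p, rfl⟩, hext⟩
      refine S.mem_extremePoints_of_ergodic (hinv p).1
        (MeasureIsomorphic.ergodic (hiso p) (herg p ⟨p.2, ?_⟩) (hinv p).2)
      rintro x hx y hy ⟨a, b, ha, hb, hab, hpab⟩
      lift a to ℝ≥0 using ha.le
      lift b to ℝ≥0 using hb.le
      have h1 : ρ ⟨x, hx⟩ = ρ p := by
        refine hext ⟨_, rfl⟩ ⟨⟨y, hy⟩, rfl⟩
          ⟨a, b, by exact_mod_cast ha, by exact_mod_cast hb, by exact_mod_cast hab, ?_⟩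
        exact (haff ⟨x, hx⟩ ⟨y, hy⟩ p a b (by exact_mod_cast hab) hpab.symm).symm
      exact congrArg Subtype.val (hinj h1)
  have hemb : IsClosedEmbedding ρ := hρ.isClosedEmbedding hinj
  exact ⟨range ρ, hF, hemb.isEmbedding.toHomeomorph, haff, hiso⟩

/-! ### Measures on the extreme boundary -/

theorem continuous_of_isClosed_graph {Y W : Type*} [TopologicalSpace Y] [TopologicalSpace W]
    [CompactSpace W] {f : Y → W} (h : IsClosed {z : Y × W | z.2 = f z.1}) : Continuous f := by
  refine continuous_iff_isClosed.2 fun C hC => ?_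
  have := isClosedMap_fst_of_compactSpace _ (h.inter (hC.preimage continuous_snd))
  convert! this using 1
  ext y
  simp

section Boundary

variable {E : Type*} [AddCommGroup E] [Module ℝ E] [MetricSpace E] [MeasurableSpace E]
  {K : Set E}

theorem IsZeroDimBauerSimplex.compactSpace_extremePoints (hK : IsZeroDimBauerSimplex K) :
    CompactSpace (K.extremePoints ℝ) :=
  isCompact_iff_compactSpace.1
    (hK.compact.of_isClosed_subset hK.closed_extremePoints extremePoints_subset)

/-- The measure on the extreme points of a Bauer simplex that represents a point depends
continuously on the point. -/
theorem IsZeroDimBauerSimplex.continuous_of_isBarycenter [BorelSpace E]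
    (hK : IsZeroDimBauerSimplex K)
    {ξ : K → ProbabilityMeasure (K.extremePoints ℝ)}
    (hξ : ∀ p, IsBarycenter K (ξ p : Measure (K.extremePoints ℝ)) p) : Continuous ξ := by
  have := hK.compactSpace_extremePoints
  refine continuous_of_isClosed_graph ?_
  have hgraph : {z : K × ProbabilityMeasure (K.extremePoints ℝ) | z.2 = ξ z.1} =
      ⋂ (f : C(K, ℝ)) (_ : IsAffine f), {z | ∫ e, f (Set.inclusion extremePoints_subset e)
        ∂(z.2 : Measure (K.extremePoints ℝ)) = f z.1} := by
    ext ⟨p, η⟩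
    simp only [mem_ofPred_eq, mem_iInter]
    constructor
    · rintro rfl f hf
      exact hξ p f f.continuous hf
    · intro h
      exact (hK.existsUnique_barycenter p).unique (fun f hf ha => h ⟨f, hf⟩ ha) (hξ p)
  rw [hgraph]
  refine isClosed_iInter fun f => isClosed_iInter fun _ => isClosed_eq ?_ (by fun_prop)
  exact (ProbabilityMeasure.continuous_integral_continuousMap
    (f.comp ⟨_, continuous_inclusion extremePoints_subset⟩)).comp continuous_snd

/-- The value at `p` of a continuous affine map to probability measures is the integral of its
values at the extreme points, with respect to a measure with barycenter `p`. -/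
theorem IsBarycenter.toMeasure_eq_map_snd_fibredIntegral [BorelSpace E] {X : Type*}
    [TopologicalSpace X] [CompactSpace X] [TopologicalSpace.MetrizableSpace X]
    [MeasurableSpace X] [BorelSpace X] (hK : IsZeroDimBauerSimplex K) {m : K → ProbabilityMeasure X} (hm : Continuous m)
    (haff : IsAffine fun p => (m p).toFiniteMeasure) {p : K}
    {ξ : ProbabilityMeasure (K.extremePoints ℝ)}
    (hξ : IsBarycenter K (ξ : Measure (K.extremePoints ℝ)) p) :
    (m p : Measure X) = (fibredIntegral (fun e => m (Set.inclusion extremePoints_subset e))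
      (hm.comp (continuous_inclusion extremePoints_subset)) ξ :
        Measure (K.extremePoints ℝ × X)).map Prod.snd := by
  have := hK.compactSpace_extremePoints
  have : IsProbabilityMeasure ((fibredIntegral
      (fun e => m (Set.inclusion extremePoints_subset e))
      (hm.comp (continuous_inclusion extremePoints_subset)) ξ :
        Measure (K.extremePoints ℝ × X)).map Prod.snd) :=
    Measure.isProbabilityMeasure_map measurable_snd.aemeasurable
  refine ext_of_forall_integral_eq_of_IsFiniteMeasure fun f => ?_
  rw [integral_map measurable_snd.aemeasurable f.continuous.aestronglyMeasurable]
  have h1 := integral_fibredIntegral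
    (hP := hm.comp (continuous_inclusion extremePoints_subset)) ξ
    (f.toContinuousMap.comp ContinuousMap.snd)
  refine Eq.trans ?_ h1.symm
  refine (hξ (fun p => ∫ x, f x ∂(m p : Measure X))
    (ProbabilityMeasure.continuous_iff_forall_continuous_integral.1 hm f) ?_).symm
  intro x y z a b hab hz
  have hmz : (m z : Measure X) = a • (m x : Measure X) + b • (m y : Measure X) :=
    congrArg (fun μ : FiniteMeasure X => (μ : Measure X)) (haff x y z a b hab hz)
  have hi : ∀ p, Integrable f (m p : Measure X) := fun p => f.integrable _
  change ∫ x, f x ∂(m z : Measure X) = _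
  rw [hmz, integral_add_measure ((hi x).smul_measure_nnreal) ((hi y).smul_measure_nnreal),
    integral_smul_nnreal_measure, integral_smul_nnreal_measure]

end Boundary

/-! ### The zero-dimensional embedding -/

/-- An aperiodic assignment on a zero-dimensional Bauer simplex that can be embedded in a topological
dynamical system can be embedded in a zero-dimensional one. -/
theorem mainTheorem4 {E : Type w} [AddCommGroup E] [Module ℝ E] [MetricSpace E]
    [IsTopologicalAddGroup E] [ContinuousSMul ℝ E] [MeasurableSpace E] [BorelSpace E]
    (K : Set E) (hK : IsZeroDimBauerSimplex K)
    (Φ : K → MPSystem.{u}) (hΦ : IsAssignment K Φ) (hper : IsAperiodicAssignment K Φ)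
    (hemb : ∃ S : TopSystem.{v}, EmbedsIn Φ S) :
    ∃ Z : TopSystem.{0}, IsZeroDimensional Z.carrier ∧ EmbedsIn Φ Z := by
  obtain ⟨S, F, hF, π, hπ, hiso⟩ := hemb
  let inc : K.extremePoints ℝ → K := Set.inclusion extremePoints_subset
  have hinc : Continuous inc := continuous_inclusion extremePoints_subset
  have hQ := hK.compactSpace_extremePoints
  -- `m p` is the invariant measure on `S` that realizes `Φ p`.
  let m : K → ProbabilityMeasure S.carrier := fun p =>
    ⟨((π p : FiniteMeasure S.carrier) : Measure S.carrier), (hF.subset (π p).2).1⟩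
  have hmF : ∀ p, (m p).toFiniteMeasure = π p := fun p => rfl
  have hm : Continuous m := (ProbabilityMeasure.toFiniteMeasure_isEmbedding _).continuous_iff.2
    (continuous_subtype_val.comp π.continuous)
  have hminj : Function.Injective m := fun p p' h =>
    π.injective (Subtype.ext (congrArg ProbabilityMeasure.toFiniteMeasure h))
  have hminv : ∀ p, MeasurePreserving S.T (m p : Measure S.carrier) (m p) :=
    fun p => (hF.subset (π p).2).2
  have hmerg : ∀ e, Ergodic S.T (m (inc e) : Measure S.carrier) := fun e =>
    MeasureIsomorphic.ergodic (hiso (inc e)) (hΦ.ergodic _ e.2) (hminv _)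
  have hP : Continuous (m ∘ inc) := hm.comp hinc
  obtain ⟨Z, φ, hZ, hφ, hφT, hφinj, hφc⟩ :=
    exists_coding hK.zeroDim_extremePoints hP S.T fun e => hminv (inc e)
  refine ⟨Z, hZ, ?_⟩
  choose ξ hξ using fun p => (hK.existsUnique_barycenter p).exists
  have hξc := hK.continuous_of_isBarycenter hξ
  rcases isEmpty_or_nonempty K with hKe | ⟨⟨p₀⟩⟩
  · exact Z.embedsIn_of_continuous_injective hK.compact hK.convex (fun p => (hKe.false p).elim)
      (continuous_of_const fun p => (hKe.false p).elim) (fun p => (hKe.false p).elim)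
      (fun p => (hKe.false p).elim) (fun p => (hKe.false p).elim) (fun p => (hKe.false p).elim)
      hΦ.ergodic
  have : Nonempty (K.extremePoints ℝ) := nonempty_of_isProbabilityMeasure (ξ p₀ : Measure _)
  have : Nonempty S.carrier := nonempty_of_isProbabilityMeasure (m p₀ : Measure _)
  obtain ⟨q, hq, hqe⟩ := exists_measurable_ae_eq_index hP
    (hminj.comp (Set.inclusion_injective _)) S.T.continuous hmerg
  -- `Λ p` lifts `m p` to the graph of `q`; although `q` is only Borel, it depends continuously
  -- on `p`.
  let Λ : K → ProbabilityMeasure (K.extremePoints ℝ × S.carrier) :=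
    fun p => fibredIntegral (m ∘ inc) hP (ξ p)
  have hΛ : Continuous Λ := continuous_fibredIntegral.comp hξc
  have hmΛ : ∀ p, (m p : Measure S.carrier) =
      (Λ p : Measure (K.extremePoints ℝ × S.carrier)).map Prod.snd := fun p =>
    IsBarycenter.toMeasure_eq_map_snd_fibredIntegral hK hm (fun x y z a b hab hz => by
      simpa only [hmF] using hπ x y z a b hab hz) (hξ p)
  -- The required map sends `p` to the push-forward of `m p` under `ψ`, which is that of `Λ p`
  -- under `φ`.
  let ψ : S.carrier → Z.carrier := fun x => φ (q x, x)
  have hψ : Measurable ψ := hφ.comp (hq.prodMk measurable_id)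
  have hψinj : Function.Injective ψ := fun x x' h => hφinj _ _ _ _ h
  have hqΛ : ∀ p, ∀ᵐ z ∂(Λ p : Measure (K.extremePoints ℝ × S.carrier)), q z.2 = z.1 := fun p =>
    ae_fibredIntegral (measurableSet_eq_fun (hq.comp measurable_snd) measurable_fst) hqe
  have hqTΛ : ∀ p, ∀ᵐ z ∂(Λ p : Measure (K.extremePoints ℝ × S.carrier)), q (S.T z.2) = z.1 :=
    fun p => ae_fibredIntegral (measurableSet_eq_fun
      (hq.comp (S.T.continuous.measurable.comp measurable_snd)) measurable_fst)
      fun e => (hminv (inc e)).quasiMeasurePreserving.ae (hqe e)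
  have hmap : ∀ p, (m p : Measure S.carrier).map ψ =
      (Λ p : Measure (K.extremePoints ℝ × S.carrier)).map φ := by
    intro p
    rw [hmΛ, Measure.map_map hψ measurable_snd]
    refine Measure.map_congr ?_
    filter_upwards [hqΛ p] with z hz
    simp [ψ, hz]
  have hψT : ∀ p, ∀ᵐ x ∂(m p : Measure S.carrier), ψ (S.T x) = Z.T (ψ x) := by
    intro p
    have hset : MeasurableSet {x | q (S.T x) = q x} :=
      measurableSet_eq_fun (hq.comp S.T.continuous.measurable) hq
    have : ∀ᵐ x ∂(m p : Measure S.carrier), q (S.T x) = q x := by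
      rw [hmΛ, ae_map_iff measurable_snd.aemeasurable hset]
      filter_upwards [hqΛ p, hqTΛ p] with z h1 h2
      rw [h1, h2]
    filter_upwards [this] with x hx
    simp only [ψ, hx, hφT]
  have hφΛ : ∀ p, ∀ᵐ z ∂(Λ p : Measure (K.extremePoints ℝ × S.carrier)), ContinuousAt φ z :=
    fun p => ae_fibredIntegral (measurableSet_of_continuousAt φ) hφc
  let ρ : K → FiniteMeasure Z.carrier := fun p => (π p : FiniteMeasure S.carrier).map ψ
  have hρ : Continuous ρ := by
    have h1 : Continuous fun p => (Λ p).map hφ.aemeasurable :=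
      continuous_iff_continuousAt.2 fun p =>
        tendsto_map_of_ae_continuousAt (hΛ.tendsto p) hφ (hφΛ p)
    refine (ProbabilityMeasure.toFiniteMeasure_continuous.comp h1).congr fun p => ?_
    exact Subtype.ext (hmap p).symm
  have hρinj : Function.Injective ρ := by
    intro p p' h
    refine hminj (ProbabilityMeasure.toMeasure_injective ?_)
    have h' : (m p : Measure S.carrier).map ψ = (m p' : Measure S.carrier).map ψ :=
      congrArg (fun μ : FiniteMeasure Z.carrier => (μ : Measure Z.carrier)) h
    have hψe := hψ.measurableEmbedding hψinj
    rw [← hψe.comap_map (m p : Measure S.carrier), h', hψe.comap_map]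
  have hρinv : ∀ p, ρ p ∈ Z.invariantMeasures := by
    intro p
    refine ⟨Measure.isProbabilityMeasure_map (μ := (m p : Measure S.carrier)) hψ.aemeasurable,
      Z.T.continuous.measurable, ?_⟩
    change ((m p : Measure S.carrier).map ψ).map Z.T = (m p : Measure S.carrier).map ψ
    rw [Measure.map_map Z.T.continuous.measurable hψ]
    conv_rhs => rw [← (hminv p).map_eq, Measure.map_map hψ S.T.continuous.measurable]
    refine Measure.map_congr ?_
    filter_upwards [hψT p] with x hx
    exact hx.symm
  refine Z.embedsIn_of_continuous_injective hK.compact hK.convex ρ hρ hρinj ?_ hρinv ?_ hΦ.ergodic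
  · intro x y z a b hab hz
    have h : (π z : FiniteMeasure S.carrier) = a • (π x : FiniteMeasure S.carrier) +
        b • (π y : FiniteMeasure S.carrier) := hπ x y z a b hab hz
    simp only [ρ]
    rw [h, FiniteMeasure.map_add hψ, FiniteMeasure.map_smul,
      FiniteMeasure.map_smul]
  · intro p
    exact MeasureIsomorphic.trans (hiso p)
      (MeasureIsomorphic.map_of_injective (μ := (m p : Measure S.carrier)) hψ hψinj (hψT p))
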